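/- Let $(\Omega,\mathcal F,(\mathcal F_t)_{t\ge 0},P)$ be a filtered probability space and let $M=(M_t)_{t\ge 0}$ be a nonnegative continuous $(\mathcal F_t)$-local martingale with $M_0=1$ and $M_t\to 0$ a.s. as $t\to\infty$. Let $0<K\le 1$, and let $$\mathcal G_K=\sup\{t\ge 0:\ M_t=K\}$$ be the last time at which $M$ is at level $K$. Then, for every $t\ge 0$, $$Z_t:=P(\mathcal G_K\ge t\mid\mathcal F_t)=1\wedge\frac{M_t}{K}\qquad\text{a.s.}$$ Consequently, for every $t\ge 0$, the function $m(t):=E\big[(1_{\{\mathcal G_K\ge t\}}-Z_t)^2\big]$ satisfies $$m(t)=E\big[Z_t(1-Z_t)\big]=\frac1{K^2}\,E\big[M_t\,(K-M_t)^+\big].$$ -/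

import Mathlib

open MeasureTheory ProbabilityTheory Filter Topology
open scoped NNReal ENNReal

noncomputable section

/-- `M` is a local martingale for the filtration `𝓕` under `P`: it is adapted, and there is a
sequence of stopping times `τ n`, a.s. nondecreasing and tending to `∞`, such that each stopped
process `M^{τ n} 1_{τ n > 0}` is a martingale. -/
def IsLocalMartingale {Ω : Type*} {mΩ : MeasurableSpace Ω} (M : ℝ≥0 → Ω → ℝ)
    (𝓕 : Filtration ℝ≥0 mΩ) (P : Measure Ω) : Prop :=
  StronglyAdapted 𝓕 M ∧ Locally (fun Y : ℝ≥0 → Ω → ℝ => Martingale Y 𝓕 P) 𝓕 M P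

/-- The last passage time `sup {t ≥ 0 : M_t = K}` of `M` at the level `K`, a random time with
values in `[0, ∞]`. -/
def lastPassageTime {Ω : Type*} (M : ℝ≥0 → Ω → ℝ) (K : ℝ) (ω : Ω) : ℝ≥0∞ :=
  sSup ((fun t : ℝ≥0 => (t : ℝ≥0∞)) '' {t : ℝ≥0 | M t ω = K})

/-- The random variable `1_{G ≥ t}`. -/
def survivalIndicator {Ω : Type*} (G : Ω → ℝ≥0∞) (t : ℝ≥0) : Ω → ℝ :=
  {ω | (t : ℝ≥0∞) ≤ G ω}.indicator (fun _ => (1 : ℝ))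

/-- The Azéma supermartingale `Z_t = P(G ≥ t | 𝓕_t)` of the random time `G`. -/
def azemaSupermartingale {Ω : Type*} {mΩ : MeasurableSpace Ω} (G : Ω → ℝ≥0∞)
    (𝓕 : Filtration ℝ≥0 mΩ) (P : Measure Ω) (t : ℝ≥0) : Ω → ℝ :=
  P[survivalIndicator G t | 𝓕 t]

/-- `m_G(t) = E[(1_{G ≥ t} - P(G ≥ t | 𝓕_t))²]`. -/
def nonStoppingTimeness {Ω : Type*} {mΩ : MeasurableSpace Ω} (G : Ω → ℝ≥0∞)
    (𝓕 : Filtration ℝ≥0 mΩ) (P : Measure Ω) (t : ℝ≥0) : ℝ :=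
  ∫ ω, (survivalIndicator G t ω - azemaSupermartingale G 𝓕 P t ω) ^ 2 ∂P

end

/-! This is Doob's maximal identity. Fix `a < K` and freeze `M` at its first passage above `a` after
`t`. Where `M_t < a`, the frozen process stays in `[0, a]`, so it is a bounded martingale; it ends
at `a` if the passage occurs and at `0` otherwise. Hence `a * P(passage | 𝓕 t) = M_t` there. Letting
`a ↑ K`, passages become `{sup_{s ≥ t} M_s ≥ K}`, which is `{G_K ≥ t}` by continuity and decay to
`0`.

Four limits are taken in turn: dyadic mesh (`setIntegral_crossValue`), localization
(`setIntegral_crossValue_sub_of_isLocalMartingale`), then horizon and level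
(`setIntegral_survivalIndicator_sub`). The second moment formula follows by algebra from `I² = I`.
-/

/-! ### Freezing a path at a first passage -/

open scoped Classical in
/-- The value at time `t + L` of the path `g` frozen at its first passage above `a` after time `t`,
the passage being detected along the dyadic grid started at `t`. -/
noncomputable def crossValue (t : ℝ≥0) (a : ℝ) (L : ℕ) (g : ℝ≥0 → ℝ) : ℝ :=
  if g t < a then
    if ∃ n k : ℕ, k ≤ L * 2 ^ n ∧ a ≤ g (t + k / 2 ^ n) then a else g (t + L)
  else g t

/-- The bound depends on neither the path nor `L`, so it dominates the localization and horizon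
limits without using integrability of `M_t`. -/
lemma abs_crossValue_sub_le {t : ℝ≥0} {a : ℝ} {L : ℕ} {g : ℝ≥0 → ℝ} (hg : ∀ s, 0 ≤ g s)
    (ha : 0 ≤ a) : |crossValue t a L g - g t| ≤ a := by
  have h0 := hg t
  have h1 := hg (t + L)
  unfold crossValue
  split_ifs with h2 h3
  · rw [abs_le]; constructor <;> linarith
  · have : g (t + L) < a := by
      by_contra! h
      -- The endpoint `t + L` is itself a grid point.
      exact h3 ⟨0, L, by simp, by simpa using h⟩
    rw [abs_le]; constructor <;> linarith
  · simpa using ha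

lemma crossValue_congr {t : ℝ≥0} {a : ℝ} {L : ℕ} {g h : ℝ≥0 → ℝ}
    (hgh : ∀ s ≤ t + L, g s = h s) : crossValue t a L g = crossValue t a L h := by
  have h1 : (∃ n k : ℕ, k ≤ L * 2 ^ n ∧ a ≤ g (t + k / 2 ^ n)) ↔
      ∃ n k : ℕ, k ≤ L * 2 ^ n ∧ a ≤ h (t + k / 2 ^ n) := by
    refine exists_congr fun n => exists_congr fun k => and_congr_right fun hk => ?_
    rw [hgh]
    gcongr
    rw [div_le_iff₀ (by positivity)]
    exact_mod_cast hk
  unfold crossValue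
  rw [hgh t (by simp), hgh (t + L) le_rfl]
  split_ifs with h2 h3 h4 h4
  · rfl
  · exact absurd (h1.1 h3) h4
  · exact absurd (h1.2 h4) h3
  · rfl
  · rfl

/-- Grids are nested, so a hit persists under refinement. The first hit has value at least `a` and
its predecessor, at distance `2⁻ⁿ`, has value below `a`; uniform continuity squeezes the value to
`a`. -/
lemma tendsto_eval_first_grid_hit {g : ℝ≥0 → ℝ} (hg : Continuous g) {t : ℝ≥0} {a : ℝ} {L : ℕ}
    {ρ : ℕ → ℕ}
    (h_le : ∀ n, ρ n ≤ L * 2 ^ n)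
    (h_hit : ∀ n, (∃ k : ℕ, k ≤ L * 2 ^ n ∧ a ≤ g (t + k / 2 ^ n)) → a ≤ g (t + ρ n / 2 ^ n))
    (h_lt : ∀ n, ∀ k < ρ n, g (t + k / 2 ^ n) < a)
    (h_end : ∀ n, (¬ ∃ k : ℕ, k ≤ L * 2 ^ n ∧ a ≤ g (t + k / 2 ^ n)) → ρ n = L * 2 ^ n) :
    Tendsto (fun n => g (t + ρ n / 2 ^ n)) atTop (𝓝 (crossValue t a L g)) := by
  unfold crossValue
  split_ifs with ht hex
  · obtain ⟨n₀, k₀, hk₀, hak₀⟩ := hex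
    have hhit : ∀ n ≥ n₀, a ≤ g (t + ρ n / 2 ^ n) := by
      intro n hn
      refine h_hit n ⟨k₀ * 2 ^ (n - n₀), ?_, ?_⟩
      · calc k₀ * 2 ^ (n - n₀) ≤ L * 2 ^ n₀ * 2 ^ (n - n₀) := by gcongr
          _ = L * 2 ^ n := by rw [mul_assoc, ← pow_add]; congr 2; omega
      · have : ((k₀ * 2 ^ (n - n₀) : ℕ) : ℝ≥0) / 2 ^ n = k₀ / 2 ^ n₀ := by
          have h2 : (2 : ℝ≥0) ^ n = 2 ^ n₀ * 2 ^ (n - n₀) := by rw [← pow_add]; congr 1; omega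
          rw [h2]; push_cast
          rw [mul_div_mul_right _ _ (by positivity)]
        rwa [this]
    rw [Metric.tendsto_atTop]
    intro ε hε
    have huc : UniformContinuousOn g (Set.Icc 0 (t + L)) :=
      isCompact_Icc.uniformContinuousOn_of_continuous hg.continuousOn
    obtain ⟨δ, hδ, hgδ⟩ := Metric.uniformContinuousOn_iff.1 huc ε hε
    obtain ⟨n₁, hn₁⟩ := exists_pow_lt_of_lt_one hδ (by norm_num : (1 / 2 : ℝ) < 1)
    refine ⟨max n₀ n₁, fun n hn => ?_⟩
    have hge := hhit n (le_of_max_le_left hn)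
    have hpos : ρ n ≠ 0 := by
      intro h0
      rw [h0] at hge
      simp at hge
      linarith
    obtain ⟨j, hj⟩ := Nat.exists_eq_succ_of_ne_zero hpos
    have hj1 := h_lt n j (by omega)
    have hmem : ∀ k ≤ ρ n, t + (k : ℝ≥0) / 2 ^ n ∈ Set.Icc 0 (t + (L : ℝ≥0)) := by
      intro k hk
      refine ⟨zero_le, ?_⟩
      gcongr
      rw [div_le_iff₀ (by positivity)]
      exact_mod_cast hk.trans (h_le n)
    have hd := hgδ _ (hmem (ρ n) le_rfl) _ (hmem j (by omega)) (by
      rw [hj, NNReal.dist_eq]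
      push_cast
      have : (t : ℝ) + (j + 1) / 2 ^ n - (t + j / 2 ^ n) = (1 / 2) ^ n := by
        rw [div_pow, one_pow]; ring
      rw [this, abs_of_pos (by positivity)]
      refine lt_of_le_of_lt ?_ hn₁
      exact pow_le_pow_of_le_one (by norm_num) (by norm_num) (le_of_max_le_right hn))
    rw [Real.dist_eq] at hd ⊢
    rw [abs_lt] at hd ⊢
    constructor <;> linarith [hd.1, hd.2]
  · refine tendsto_const_nhds.congr fun n => ?_
    rw [h_end n fun ⟨k, hk⟩ => hex ⟨n, k, hk⟩]
    congr 2
    push_cast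
    rw [mul_div_cancel_right₀ _ (by positivity)]
  · refine tendsto_const_nhds.congr fun n => ?_
    have : ρ n = 0 := by
      by_contra h
      exact ht (by simpa using h_lt n 0 (Nat.pos_of_ne_zero h))
    simp [this]

/-! ### Optional stopping along the grid -/

lemma exists_condExp_eq_stoppedValue_hittingBtwn {Ω : Type*} {mΩ : MeasurableSpace Ω}
    {P : Measure Ω} [IsFiniteMeasure P] {𝓖 : Filtration ℕ mΩ} {f : ℕ → Ω → ℝ}
    (hf : Martingale f 𝓖 P) {s : Set ℝ} (hs : MeasurableSet s) (m : ℕ) :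
    ∃ m' : MeasurableSpace Ω, m' ≤ mΩ ∧ 𝓖 0 ≤ m' ∧
      (fun ω => f (hittingBtwn f s 0 m ω) ω) =ᵐ[P] P[f m | m'] := by
  have hτ : IsStoppingTime 𝓖 (fun ω => ((hittingBtwn f s 0 m ω : ℕ) : WithTop ℕ)) :=
    Adapted.isStoppingTime_hittingBtwn (fun i => (hf.stronglyAdapted i).measurable) hs
  have hle : ∀ ω, ((hittingBtwn f s 0 m ω : ℕ) : WithTop ℕ) ≤ (m : ℕ) := fun ω => by
    exact WithTop.coe_le_coe.2 (hittingBtwn_le (u := f) ω)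
  refine ⟨hτ.measurableSpace, hτ.measurableSpace_le, ?_, ?_⟩
  · have h0 := IsStoppingTime.measurableSpace_mono (isStoppingTime_const 𝓖 0) hτ
      (fun ω => by simp)
    rwa [IsStoppingTime.measurableSpace_const] at h0
  · have := hf.stoppedValue_ae_eq_condExp_of_le_const hτ hle
    exact this

/-- All grid approximations are conditional expectations of the single variable `N (t + L)`, hence
uniformly integrable, and almost sure convergence upgrades to convergence in `L¹`. -/
lemma setIntegral_crossValue {Ω : Type*} {mΩ : MeasurableSpace Ω}
    {P : Measure Ω} [IsFiniteMeasure P] {𝓕 : Filtration ℝ≥0 mΩ} {N : ℝ≥0 → Ω → ℝ}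
    (hN : Martingale N 𝓕 P) (hcont : ∀ᵐ ω ∂P, Continuous (fun s => N s ω))
    (t : ℝ≥0) (a : ℝ) (L : ℕ) :
    Integrable (fun ω => crossValue t a L (fun s => N s ω)) P ∧
    ∀ A, MeasurableSet[𝓕 t] A →
      ∫ ω in A, crossValue t a L (fun s => N s ω) ∂P = ∫ ω in A, N t ω ∂P := by
  let f : ℕ → ℕ → Ω → ℝ := fun n k => N (t + k / 2 ^ n)
  have hmono : ∀ n : ℕ, Monotone fun k : ℕ => t + (k : ℝ≥0) / 2 ^ n := fun n i j hij => by
    dsimp only; gcongr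
  let 𝓖 : ℕ → Filtration ℕ mΩ := fun n =>
    { seq := fun k => 𝓕 (t + k / 2 ^ n)
      mono' := fun i j hij => 𝓕.mono (hmono n hij)
      le' := fun k => 𝓕.le _ }
  have hf : ∀ n, Martingale (f n) (𝓖 n) P := fun n =>
    ⟨fun k => hN.1 _, fun i j hij => hN.2 _ _ (hmono n hij)⟩
  have hend : ∀ n, f n (L * 2 ^ n) = N (t + L) := by
    intro n
    simp only [f]
    congr 2
    push_cast
    rw [mul_div_cancel_right₀ _ (by positivity)]
  choose m' hm' hm0 hV using fun n =>
    exists_condExp_eq_stoppedValue_hittingBtwn (hf n) (measurableSet_Ici (a := a)) (L * 2 ^ n)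
  simp only [hend] at hV
  set ρ : ℕ → Ω → ℕ := fun n => hittingBtwn (f n) (Set.Ici a) 0 (L * 2 ^ n) with hρ
  set V : ℕ → Ω → ℝ := fun n ω => f n (ρ n ω) ω with hVdef
  have hlim : ∀ᵐ ω ∂P, Tendsto (fun n => V n ω) atTop
      (𝓝 (crossValue t a L (fun s => N s ω))) := by
    filter_upwards [hcont] with ω hω
    refine tendsto_eval_first_grid_hit (ρ := fun n => ρ n ω) hω (fun n => hittingBtwn_le ω)
      (fun n ⟨k, hk, hak⟩ => ?_) (fun n k hk => ?_) (fun n hn => ?_)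
    · exact hittingBtwn_mem_set (u := f n) (s := Set.Ici a) ⟨k, ⟨zero_le, hk⟩, hak⟩
    · have := notMem_of_lt_hittingBtwn hk zero_le
      simpa [f] using this
    -- Without a hit, `hittingBtwn` defaults to the upper end of its range.
    · simp only [hρ, hittingBtwn]
      rw [if_neg]
      rintro ⟨k, hk, hak⟩
      exact hn ⟨k, hk.2, hak⟩
  have hUI : UniformIntegrable V 1 P :=
    ((hN.integrable (t + L)).uniformIntegrable_condExp hm').ae_eq fun n => (hV n).symm
  have hVm : ∀ n, AEStronglyMeasurable (V n) P := fun n => hUI.1 n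
  have hmeas : AEStronglyMeasurable (fun ω => crossValue t a L (fun s => N s ω)) P :=
    aestronglyMeasurable_of_tendsto_ae atTop hVm hlim
  have hVA : ∀ n A, MeasurableSet[𝓕 t] A → ∫ ω in A, V n ω ∂P = ∫ ω in A, N t ω ∂P := by
    intro n A hA
    have hA' : MeasurableSet[m' n] A := hm0 n _ (𝓕.mono (i := t) (by simp) _ hA)
    rw [setIntegral_congr_ae₀ (g := P[N (t + L) | m' n]) (hm' n _ hA').nullMeasurableSet
      (by filter_upwards [hV n] with ω h _ using h),
      setIntegral_condExp (hm' n) (hN.integrable _) hA', hN.setIntegral_eq (self_le_add_right t _) hA]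
  have hint : Integrable (fun ω => crossValue t a L (fun s => N s ω)) P := by
    refine Integrable.mono' ((hN.integrable (t + L)).norm.add
      ((hN.integrable t).norm.add (integrable_const |a|))) hmeas (ae_of_all _ fun ω => ?_)
    simp only [Pi.add_apply, Real.norm_eq_abs]
    have h1 := abs_nonneg (N (t + L) ω)
    have h2 := abs_nonneg (N t ω)
    have h3 := abs_nonneg a
    unfold crossValue
    split_ifs <;> linarith
  refine ⟨hint, fun A hA => ?_⟩
  have hL1 := tendsto_Lp_finite_of_tendsto_ae le_rfl ENNReal.one_ne_top hVm
    (memLp_one_iff_integrable.2 hint) hUI.unifIntegrable hlim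
  have := tendsto_setIntegral_of_L1' _ hmeas
    (Eventually.of_forall fun n => memLp_one_iff_integrable.1 (hUI.memLp n)) hL1 A
  simp only [hVA _ A hA] at this
  exact tendsto_nhds_unique this tendsto_const_nhds

lemma setIntegral_eq_zero_of_tendsto_of_bounded {Ω : Type*} {m _mΩ : MeasurableSpace Ω}
    {P : Measure Ω} [IsFiniteMeasure P] {F : ℕ → Ω → ℝ} {f : Ω → ℝ} {C : ℝ}
    (hF : ∀ n, AEStronglyMeasurable (F n) P)
    (hFA : ∀ n A, MeasurableSet[m] A → ∫ ω in A, F n ω ∂P = 0)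
    (hC : ∀ n, ∀ᵐ ω ∂P, |F n ω| ≤ C)
    (hlim : ∀ᵐ ω ∂P, Tendsto (fun n => F n ω) atTop (𝓝 (f ω))) :
    AEStronglyMeasurable f P ∧ ∀ A, MeasurableSet[m] A → ∫ ω in A, f ω ∂P = 0 := by
  refine ⟨aestronglyMeasurable_of_tendsto_ae atTop hF hlim, fun A hA => ?_⟩
  have := tendsto_integral_of_dominated_convergence (μ := P.restrict A) (fun _ => C)
    (fun n => (hF n).restrict) (integrable_const C) (fun n => ae_restrict_of_ae (hC n))
    (ae_restrict_of_ae hlim)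
  simp only [hFA _ A hA] at this
  exact tendsto_nhds_unique this tendsto_const_nhds

/-! ### Last passage and limits of paths -/

lemma exists_ge_eq_of_tendsto_zero {g : ℝ≥0 → ℝ} (hg : Continuous g)
    (hlim : Tendsto g atTop (𝓝 0)) {K : ℝ} (hK : 0 < K) {s : ℝ≥0} (hs : K ≤ g s) :
    ∃ u ≥ s, g u = K := by
  obtain ⟨v, hv, hsv⟩ := ((hlim.eventually_lt_const hK).and (eventually_ge_atTop s)).exists
  obtain ⟨u, hu, hgu⟩ := intermediate_value_Icc' hsv hg.continuousOn ⟨hv.le, hs⟩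
  exact ⟨u, hu.1, hgu⟩

lemma exists_forall_ge_le_of_tendsto_zero {g : ℝ≥0 → ℝ} (hg : Continuous g)
    (hlim : Tendsto g atTop (𝓝 0)) {K : ℝ} (hK : 0 < K) {t : ℝ≥0} (hlt : ∀ s ≥ t, g s < K) :
    ∃ c < K, ∀ s ≥ t, g s ≤ c := by
  obtain ⟨T, hT⟩ := eventually_atTop.1 (hlim.eventually_lt_const (half_pos hK))
  obtain ⟨x, hx, hmax⟩ := (isCompact_Icc (a := t) (b := max t T)).exists_isMaxOn
    ⟨t, le_rfl, le_max_left _ _⟩ hg.continuousOn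
  refine ⟨max (g x) (K / 2), max_lt (hlt x hx.1) (half_lt_self hK), fun s hs => ?_⟩
  rcases le_total s (max t T) with h | h
  · exact (hmax ⟨hs, h⟩).trans (le_max_left _ _)
  · exact (hT s ((le_max_right _ _).trans h)).le.trans (le_max_right _ _)

lemma exists_dyadic_lt {g : ℝ≥0 → ℝ} (hg : Continuous g) {t s : ℝ≥0} (hs : t ≤ s) {a : ℝ}
    (ha : a < g s) : ∃ n k : ℕ, a < g (t + k / 2 ^ n) := by
  have h1 : Tendsto (fun n : ℕ => (⌊((s - t : ℝ≥0) : ℝ) * 2 ^ n⌋₊ : ℝ≥0) / 2 ^ n) atTop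
      (𝓝 (s - t)) := by
    rw [← NNReal.tendsto_coe]
    push_cast
    exact (tendsto_nat_floor_mul_div_atTop (R := ℝ) (s - t).coe_nonneg).comp
      (tendsto_pow_atTop_atTop_of_one_lt (by norm_num : (1 : ℝ) < 2))
  have h2 : Tendsto (fun n : ℕ => g (t + (⌊((s - t : ℝ≥0) : ℝ) * 2 ^ n⌋₊ : ℝ≥0) / 2 ^ n)) atTop
      (𝓝 (g s)) := by
    have := (hg.tendsto _).comp (tendsto_const_nhds (x := t) |>.add h1)
    rwa [add_tsub_cancel_of_le hs] at this
  obtain ⟨n, hn⟩ := (h2.eventually_const_lt ha).exists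
  exact ⟨n, _, hn⟩

/-- Decay makes the level set compact, so the supremum is attained. `K ≤ M 0 ω` makes it nonempty,
which matters at `t = 0` since `sSup ∅ = 0`. -/
lemma le_lastPassageTime_iff {Ω : Type*} {M : ℝ≥0 → Ω → ℝ} {ω : Ω}
    (hg : Continuous (fun s => M s ω)) (hlim : Tendsto (fun s => M s ω) atTop (𝓝 0))
    {K : ℝ} (hK : 0 < K) (h0 : K ≤ M 0 ω) (t : ℝ≥0) :
    (t : ℝ≥0∞) ≤ lastPassageTime M K ω ↔ ∃ s ≥ t, K ≤ M s ω := by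
  constructor
  · intro h
    obtain ⟨u, -, hu⟩ := exists_ge_eq_of_tendsto_zero hg hlim hK h0
    obtain ⟨T, hT⟩ := eventually_atTop.1 (hlim.eventually_lt_const hK)
    have hcpt : IsCompact {s : ℝ≥0 | M s ω = K} := by
      refine (isCompact_Icc (a := 0) (b := T)).of_isClosed_subset
        (isClosed_eq hg continuous_const) fun s hs => ⟨zero_le, ?_⟩
      by_contra! h
      exact (hT s h.le).ne hs
    obtain ⟨x, hx, hmax⟩ := hcpt.exists_isGreatest ⟨u, hu⟩
    refine ⟨x, ?_, (show M x ω = K from hx).ge⟩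
    have : lastPassageTime M K ω ≤ x := by
      refine sSup_le ?_
      rintro _ ⟨s, hs, rfl⟩
      exact ENNReal.coe_le_coe.2 (hmax hs)
    exact ENNReal.coe_le_coe.1 (h.trans this)
  · rintro ⟨s, hts, hs⟩
    obtain ⟨u, hu, hgu⟩ := exists_ge_eq_of_tendsto_zero hg hlim hK hs
    exact (ENNReal.coe_le_coe.2 (hts.trans hu)).trans (le_sSup ⟨u, hgu, rfl⟩)

open scoped Classical in
/-- The limit of `crossValue t a L g` as `L → ∞` for a path `g` vanishing at infinity. -/
noncomputable def crossLimit (t : ℝ≥0) (a : ℝ) (g : ℝ≥0 → ℝ) : ℝ :=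
  if g t < a then if ∃ n k : ℕ, a ≤ g (t + k / 2 ^ n) then a else 0 else g t

lemma abs_crossLimit_sub_le {t : ℝ≥0} {a : ℝ} {g : ℝ≥0 → ℝ} (hg : ∀ s, 0 ≤ g s)
    (ha : 0 ≤ a) : |crossLimit t a g - g t| ≤ a := by
  have h0 := hg t
  unfold crossLimit
  split_ifs with h2 h3
  · rw [abs_le]; constructor <;> linarith
  · rw [abs_le]; constructor <;> linarith
  · simpa using ha

lemma tendsto_crossValue {t : ℝ≥0} {a : ℝ} {g : ℝ≥0 → ℝ} (hlim : Tendsto g atTop (𝓝 0)) :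
    Tendsto (fun L => crossValue t a L g) atTop (𝓝 (crossLimit t a g)) := by
  unfold crossLimit
  split_ifs with h1 h2
  · obtain ⟨n, k, hk⟩ := h2
    refine tendsto_const_nhds.congr' ?_
    filter_upwards [eventually_ge_atTop k] with L hL
    have hex : ∃ n k : ℕ, k ≤ L * 2 ^ n ∧ a ≤ g (t + k / 2 ^ n) :=
      ⟨n, k, hL.trans (Nat.le_mul_of_pos_right _ (by positivity)), hk⟩
    rw [crossValue, if_pos h1, if_pos hex]
  · have h3 : ∀ L, crossValue t a L g = g (t + L) := fun L => by
      rw [crossValue, if_pos h1, if_neg]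
      rintro ⟨n, k, -, hk⟩
      exact h2 ⟨n, k, hk⟩
    simp only [h3]
    exact hlim.comp (tendsto_atTop_mono (fun L : ℕ => self_le_add_left (L : ℝ≥0) t)
      tendsto_natCast_atTop_atTop)
  · simp [crossValue, h1]

/-- Levels strictly below `K` are essential: a path may touch `K` only off the grid, but it then
exceeds `a j` on the grid. -/
lemma tendsto_crossLimit {Ω : Type*} {M : ℝ≥0 → Ω → ℝ} {ω : Ω}
    (hg : Continuous (fun s => M s ω)) (hlim : Tendsto (fun s => M s ω) atTop (𝓝 0))
    {K : ℝ} (hK : 0 < K) (h0 : K ≤ M 0 ω) (t : ℝ≥0) {a : ℕ → ℝ} (ha : Tendsto a atTop (𝓝 K))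
    (haK : ∀ j, a j < K) :
    Tendsto (fun j => crossLimit t (a j) (fun s => M s ω) - M t ω) atTop
      (𝓝 (K * (survivalIndicator (lastPassageTime M K) t ω - min 1 (M t ω / K)))) := by
  have hH := le_lastPassageTime_iff hg hlim hK h0 t
  rcases lt_or_ge (M t ω) K with ht | ht
  · rw [min_eq_right ((div_le_one hK).2 ht.le), mul_sub, mul_div_cancel₀ _ hK.ne']
    refine Tendsto.sub_const ?_ _
    by_cases hex : ∃ s ≥ t, K ≤ M s ω
    · have : survivalIndicator (lastPassageTime M K) t ω = 1 :=
        Set.indicator_of_mem (s := {ω | (t : ℝ≥0∞) ≤ lastPassageTime M K ω}) (hH.2 hex) _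
      rw [this, mul_one]
      refine ha.congr' ?_
      filter_upwards [ha.eventually_const_lt ht] with j hj
      obtain ⟨s, hs, hKs⟩ := hex
      obtain ⟨n, k, hnk⟩ := exists_dyadic_lt hg hs ((haK j).trans_le hKs)
      rw [crossLimit, if_pos hj, if_pos ⟨n, k, hnk.le⟩]
    · have : survivalIndicator (lastPassageTime M K) t ω = 0 :=
        Set.indicator_of_notMem (s := {ω | (t : ℝ≥0∞) ≤ lastPassageTime M K ω})
          (fun h => hex (hH.1 h)) _
      rw [this, mul_zero]
      push Not at hex
      obtain ⟨c, hc, hle⟩ := exists_forall_ge_le_of_tendsto_zero hg hlim hK hex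
      refine tendsto_const_nhds.congr' ?_
      filter_upwards [ha.eventually_const_lt ht, ha.eventually_const_lt hc] with j hj hcj
      rw [crossLimit, if_pos hj, if_neg]
      rintro ⟨n, k, hnk⟩
      exact (hnk.trans (hle _ (self_le_add_right t _))).not_gt hcj
  · have : survivalIndicator (lastPassageTime M K) t ω = 1 :=
      Set.indicator_of_mem (s := {ω | (t : ℝ≥0∞) ≤ lastPassageTime M K ω}) (hH.2 ⟨t, le_rfl, ht⟩) _
    rw [this, min_eq_left ((one_le_div hK).2 ht), sub_self, mul_zero]
    refine tendsto_const_nhds.congr fun j => ?_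
    rw [crossLimit, if_neg ((haK j).trans_le ht).not_gt, sub_self]

/-! ### From local martingales to the Azéma supermartingale -/

lemma setIntegral_crossValue_sub_of_isLocalMartingale {Ω : Type*} {mΩ : MeasurableSpace Ω}
    {P : Measure Ω} [IsFiniteMeasure P] {𝓕 : Filtration ℝ≥0 mΩ} {M : ℝ≥0 → Ω → ℝ}
    (hM : IsLocalMartingale M 𝓕 P)
    (hcont : ∀ᵐ ω ∂P, Continuous (fun t => M t ω)) (hnonneg : ∀ᵐ ω ∂P, ∀ t, 0 ≤ M t ω)
    (t : ℝ≥0) {a : ℝ} (ha : 0 ≤ a) (L : ℕ) :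
    AEStronglyMeasurable (fun ω => crossValue t a L (fun s => M s ω) - M t ω) P ∧
    ∀ A, MeasurableSet[𝓕 t] A →
      ∫ ω in A, (crossValue t a L (fun s => M s ω) - M t ω) ∂P = 0 := by
  obtain ⟨-, τ, hτ, hN⟩ := hM
  set N : ℕ → ℝ≥0 → Ω → ℝ := fun m =>
    stoppedProcess (fun i => {ω | ⊥ < τ m ω}.indicator (M i)) (τ m) with hNdef
  have hN_top : ∀ m (s : ℝ≥0) ω, ⊥ < τ m ω → (s : WithTop ℝ≥0) ≤ τ m ω → N m s ω = M s ω := by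
    intro m s ω h1 h2
    simp only [hNdef, stoppedProcess, min_eq_left h2]
    exact Set.indicator_of_mem (s := {ω | ⊥ < τ m ω}) h1 _
  have hN_cases : ∀ m ω, (∀ s, N m s ω = 0) ∨ (∀ s, N m s ω = M s ω) ∨
      ∃ c : ℝ≥0, ∀ s, N m s ω = M (min s c) ω := by
    intro m ω
    by_cases h : ⊥ < τ m ω
    · right
      have hi : ∀ i, {ω | ⊥ < τ m ω}.indicator (M i) ω = M i ω := fun i =>
        Set.indicator_of_mem (s := {ω | ⊥ < τ m ω}) h _
      simp only [hNdef, stoppedProcess, hi]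
      cases hc : τ m ω with
      | top => left; intro s; rw [min_eq_left le_top]; rfl
      | coe c => right; exact ⟨c, fun s => by rw [← WithTop.coe_min]; rfl⟩
    · left
      exact fun s => Set.indicator_of_notMem (s := {ω | ⊥ < τ m ω}) h _
  have hNc : ∀ m, ∀ᵐ ω ∂P, Continuous (fun s => N m s ω) := by
    intro m
    filter_upwards [hcont] with ω hω
    rcases hN_cases m ω with h | h | ⟨c, h⟩ <;> simp only [h]
    · exact continuous_const
    · exact hω
    · exact hω.comp (continuous_id.min continuous_const)
  have hNn : ∀ m, ∀ᵐ ω ∂P, ∀ s, 0 ≤ N m s ω := by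
    intro m
    filter_upwards [hnonneg] with ω hω s
    rcases hN_cases m ω with h | h | ⟨c, h⟩ <;> simp only [h]
    · exact le_rfl
    · exact hω _
    · exact hω _
  have hI := fun m => setIntegral_crossValue (hN m) (hNc m) t a L
  refine setIntegral_eq_zero_of_tendsto_of_bounded (C := a)
    (F := fun m ω => crossValue t a L (fun s => N m s ω) - N m t ω)
    (fun m => ((hI m).1.sub ((hN m).integrable t)).aestronglyMeasurable) (fun m A hA => ?_)
    (fun m => ?_) ?_
  · rw [integral_sub (hI m).1.integrableOn ((hN m).integrable t).integrableOn, (hI m).2 A hA,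
      sub_self]
  · filter_upwards [hNn m] with ω hω
    exact abs_crossValue_sub_le hω ha
  · filter_upwards [hτ.tendsto_top] with ω hω
    refine tendsto_const_nhds.congr' ?_
    -- Once `τ m > t + L`, the stopped and original paths agree up to `t + L`, which is all
    -- `crossValue` sees.
    filter_upwards [hω.eventually_const_lt (WithTop.coe_lt_top (t + L))] with m hm
    have h1 : ∀ s ≤ t + L, M s ω = N m s ω := fun s hs =>
      (hN_top m s ω (bot_le.trans_lt hm) ((WithTop.coe_le_coe.2 hs).trans hm.le)).symm
    rw [crossValue_congr h1, h1 t (self_le_add_right t _)]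

lemma setIntegral_survivalIndicator_sub {Ω : Type*} {mΩ : MeasurableSpace Ω}
    {P : Measure Ω} [IsFiniteMeasure P] {𝓕 : Filtration ℝ≥0 mΩ} {M : ℝ≥0 → Ω → ℝ}
    (hM : IsLocalMartingale M 𝓕 P)
    (hcont : ∀ᵐ ω ∂P, Continuous (fun t => M t ω)) (hnonneg : ∀ᵐ ω ∂P, ∀ t, 0 ≤ M t ω)
    (hlim : ∀ᵐ ω ∂P, Tendsto (fun t => M t ω) atTop (𝓝 0))
    {K : ℝ} (hK : 0 < K) (h0 : ∀ᵐ ω ∂P, K ≤ M 0 ω) (t : ℝ≥0) :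
    AEStronglyMeasurable (survivalIndicator (lastPassageTime M K) t) P ∧
    ∀ A, MeasurableSet[𝓕 t] A →
      ∫ ω in A, (survivalIndicator (lastPassageTime M K) t ω - min 1 (M t ω / K)) ∂P = 0 := by
  have hstep : ∀ a : ℝ, 0 ≤ a →
      AEStronglyMeasurable (fun ω => crossLimit t a (fun s => M s ω) - M t ω) P ∧
      ∀ A, MeasurableSet[𝓕 t] A →
        ∫ ω in A, (crossLimit t a (fun s => M s ω) - M t ω) ∂P = 0 := by
    intro a ha
    have hI := setIntegral_crossValue_sub_of_isLocalMartingale hM hcont hnonneg t ha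
    refine setIntegral_eq_zero_of_tendsto_of_bounded (C := a)
      (F := fun L ω => crossValue t a L (fun s => M s ω) - M t ω)
      (fun L => (hI L).1) (fun L => (hI L).2) (fun L => ?_) ?_
    · filter_upwards [hnonneg] with ω hω
      exact abs_crossValue_sub_le hω ha
    · filter_upwards [hlim] with ω hω
      exact (tendsto_crossValue hω).sub_const _
  let a : ℕ → ℝ := fun j => K * (1 - 1 / ((j : ℝ) + 1))
  have ha0 : ∀ j, 0 ≤ a j := fun j => by
    refine mul_nonneg hK.le (sub_nonneg.2 ?_)
    rw [div_le_one (by positivity)]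
    linarith [(Nat.cast_nonneg j : (0 : ℝ) ≤ j)]
  have haK : ∀ j, a j < K := fun j => by
    have : (0 : ℝ) < 1 / ((j : ℝ) + 1) := by positivity
    exact mul_lt_of_lt_one_right hK (by linarith)
  have ha : Tendsto a atTop (𝓝 K) := by
    have := (tendsto_one_div_add_atTop_nhds_zero_nat (𝕜 := ℝ)).const_sub 1 |>.const_mul K
    rwa [sub_zero, mul_one] at this
  obtain ⟨hm, hA⟩ := setIntegral_eq_zero_of_tendsto_of_bounded (m := 𝓕 t) (P := P) (C := K)
    (F := fun j ω => crossLimit t (a j) (fun s => M s ω) - M t ω)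
    (f := fun ω => K * (survivalIndicator (lastPassageTime M K) t ω - min 1 (M t ω / K)))
    (fun j => (hstep _ (ha0 j)).1) (fun j => (hstep _ (ha0 j)).2)
    (fun j => by
      filter_upwards [hnonneg] with ω hω
      exact (abs_crossLimit_sub_le hω (ha0 j)).trans (haK j).le)
    (by
      filter_upwards [hcont, hlim, h0] with ω h1 h2 h3
      exact tendsto_crossLimit h1 h2 hK h3 t ha haK)
  have hMt : StronglyMeasurable (M t) := (hM.1 t).mono (𝓕.le t)
  have hZ : AEStronglyMeasurable (fun ω => min 1 (M t ω / K)) P :=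
    (measurable_const.min (hMt.measurable.div_const K)).aestronglyMeasurable
  constructor
  · have := (hm.const_mul K⁻¹).add hZ
    refine this.congr (ae_of_all _ fun ω => ?_)
    simp only [Pi.add_apply]
    rw [inv_mul_cancel_left₀ hK.ne', sub_add_cancel]
  · intro A hA'
    have := hA A hA'
    rw [integral_const_mul] at this
    exact (mul_eq_zero.1 this).resolve_left hK.ne'

/-! ### Second moment and conclusion -/

/-- As `I² = I`, `(I - Z)² = Z(1 - Z) + (1 - 2Z)(I - Z)`, and the last term has mean zero because `1
- 2Z` is bounded and `m`-measurable. -/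
lemma integral_sq_indicator_sub_condExp {Ω : Type*} {m mΩ : MeasurableSpace Ω} (hm : m ≤ mΩ)
    {P : Measure Ω} [IsProbabilityMeasure P] {I : Ω → ℝ} (hI : Integrable I P)
    (hI01 : ∀ ω, I ω = 0 ∨ I ω = 1) {Z : Ω → ℝ} (hZm : StronglyMeasurable[m] Z)
    (hZ0 : ∀ᵐ ω ∂P, 0 ≤ Z ω) (hZ1 : ∀ ω, Z ω ≤ 1) (hZ : P[I | m] =ᵐ[P] Z) :
    ∫ ω, (I ω - Z ω) ^ 2 ∂P = ∫ ω, Z ω * (1 - Z ω) ∂P := by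
  have hZabs : ∀ᵐ ω ∂P, ‖Z ω‖ ≤ 1 := by
    filter_upwards [hZ0] with ω h
    rw [Real.norm_eq_abs, abs_of_nonneg h]; exact hZ1 ω
  have hZi : Integrable Z P := integrable_condExp.congr hZ
  have hWm : StronglyMeasurable[m] (fun ω => 1 - 2 * Z ω) :=
    stronglyMeasurable_const.sub (stronglyMeasurable_const.mul hZm)
  have hWb : ∀ᵐ ω ∂P, ‖1 - 2 * Z ω‖ ≤ 1 := by
    filter_upwards [hZ0] with ω h
    have := hZ1 ω
    rw [Real.norm_eq_abs, abs_le]; constructor <;> linarith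
  have hWa : AEStronglyMeasurable (fun ω => 1 - 2 * Z ω) P := (hWm.mono hm).aestronglyMeasurable
  have h0 : ∫ ω, (1 - 2 * Z ω) * (I ω - Z ω) ∂P = 0 := by
    have h1 := condExp_stronglyMeasurable_mul_of_bound hm hWm (hI.sub hZi) 1 hWb
    have h2 : P[I - Z | m] =ᵐ[P] 0 := by
      filter_upwards [condExp_sub hI hZi m, hZ,
        (condExp_of_stronglyMeasurable hm hZm hZi).eventuallyEq] with ω a b c
      simp [a, b, c]
    have h3 := integral_condExp hm (μ := P) (f := (fun ω => 1 - 2 * Z ω) * (I - Z))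
    rw [show (∫ ω, (1 - 2 * Z ω) * (I ω - Z ω) ∂P) =
      ∫ ω, ((fun ω => 1 - 2 * Z ω) * (I - Z)) ω ∂P from rfl, ← h3]
    refine integral_eq_zero_of_ae ?_
    filter_upwards [h1, h2] with ω a b
    simp [a, b]
  have hi1 : Integrable (fun ω => Z ω * (1 - Z ω)) P :=
    ((integrable_const 1).sub hZi).bdd_mul hZi.aestronglyMeasurable hZabs
  have hi2 : Integrable (fun ω => (1 - 2 * Z ω) * (I ω - Z ω)) P :=
    (hI.sub hZi).bdd_mul hWa hWb
  rw [← add_zero (∫ ω, Z ω * (1 - Z ω) ∂P), ← h0, ← integral_add hi1 hi2]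
  congr 1 with ω
  rcases hI01 ω with h | h <;> rw [h] <;> ring

theorem mainTheorem2 {Ω : Type*} {mΩ : MeasurableSpace Ω} (P : Measure Ω) [IsProbabilityMeasure P]
    (𝓕 : Filtration ℝ≥0 mΩ) (M : ℝ≥0 → Ω → ℝ)
    (hM : IsLocalMartingale M 𝓕 P)
    (hcont : ∀ᵐ ω ∂P, Continuous (fun t => M t ω))
    (hnonneg : ∀ᵐ ω ∂P, ∀ t, 0 ≤ M t ω)
    (hzero : ∀ᵐ ω ∂P, M 0 ω = 1)
    (hlim : ∀ᵐ ω ∂P, Tendsto (fun t => M t ω) atTop (𝓝 0))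
    (K : ℝ) (hK0 : 0 < K) (hK1 : K ≤ 1) (t : ℝ≥0) :
    NullMeasurableSet {ω | (t : ℝ≥0∞) ≤ lastPassageTime M K ω} P ∧
    azemaSupermartingale (lastPassageTime M K) 𝓕 P t =ᵐ[P] (fun ω => min 1 (M t ω / K)) ∧
    Integrable (fun ω => M t ω * max (K - M t ω) 0) P ∧
    nonStoppingTimeness (lastPassageTime M K) 𝓕 P t =
      ∫ ω, azemaSupermartingale (lastPassageTime M K) 𝓕 P t ω *
        (1 - azemaSupermartingale (lastPassageTime M K) 𝓕 P t ω) ∂P ∧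
    nonStoppingTimeness (lastPassageTime M K) 𝓕 P t =
      (1 / K ^ 2) * ∫ ω, M t ω * max (K - M t ω) 0 ∂P := by

  have h0 : ∀ᵐ ω ∂P, K ≤ M 0 ω := by
    filter_upwards [hzero] with ω h
    rwa [h]
  obtain ⟨hIm, hIA⟩ := setIntegral_survivalIndicator_sub hM hcont hnonneg hlim hK0 h0 t
  set I := survivalIndicator (lastPassageTime M K) t with hIdef
  set Z : Ω → ℝ := fun ω => min 1 (M t ω / K) with hZdef
  have hI01 : ∀ ω, I ω = 0 ∨ I ω = 1 := fun ω => Set.indicator_eq_zero_or_self _ _ ω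
  have hIi : Integrable I P := by
    refine Integrable.of_bound hIm 1 (ae_of_all _ fun ω => ?_)
    rcases hI01 ω with h | h <;> simp [h]
  have hZm : StronglyMeasurable[𝓕 t] Z :=
    (measurable_const.min ((hM.1 t).measurable.div_const K)).stronglyMeasurable
  have hZ0 : ∀ᵐ ω ∂P, 0 ≤ Z ω := by
    filter_upwards [hnonneg] with ω h
    exact le_min zero_le_one (div_nonneg (h t) hK0.le)
  have hZ1 : ∀ ω, Z ω ≤ 1 := fun ω => min_le_left _ _
  have hZi : Integrable Z P := by
    refine Integrable.of_bound (hZm.mono (𝓕.le t)).aestronglyMeasurable 1 ?_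
    filter_upwards [hZ0] with ω h
    rw [Real.norm_eq_abs, abs_of_nonneg h]; exact hZ1 ω
  have hZ : azemaSupermartingale (lastPassageTime M K) 𝓕 P t =ᵐ[P] Z := by
    refine (ae_eq_condExp_of_forall_setIntegral_eq (𝓕.le t) hIi (fun _ _ _ => hZi.integrableOn)
      (fun A hA _ => ?_) hZm.aestronglyMeasurable).symm
    have := hIA A hA
    rw [integral_sub hIi.integrableOn hZi.integrableOn] at this
    linarith
  -- Both sides vanish where `M_t ≥ K`; elsewhere `Z = M_t / K`.
  have hprod : ∀ ω, M t ω * max (K - M t ω) 0 = K ^ 2 * (Z ω * (1 - Z ω)) := by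
    intro ω
    simp only [hZdef]
    rcases le_total (M t ω) K with h | h
    · rw [max_eq_left (sub_nonneg.2 h), min_eq_right ((div_le_one hK0).2 h)]
      field_simp
    · rw [max_eq_right (sub_nonpos.2 h), min_eq_left ((one_le_div hK0).2 h)]
      ring
  have hZZi : Integrable (fun ω => Z ω * (1 - Z ω)) P := by
    refine ((integrable_const 1).sub hZi).bdd_mul (c := 1) hZi.aestronglyMeasurable ?_
    filter_upwards [hZ0] with ω h
    rw [Real.norm_eq_abs, abs_of_nonneg h]; exact hZ1 ω
  have hvar : nonStoppingTimeness (lastPassageTime M K) 𝓕 P t = ∫ ω, Z ω * (1 - Z ω) ∂P := by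
    rw [← integral_sq_indicator_sub_condExp (𝓕.le t) hIi hI01 hZm hZ0 hZ1 hZ]
    refine integral_congr_ae ?_
    filter_upwards [hZ] with ω h
    rw [h]
  refine ⟨?_, hZ, ?_, ?_, ?_⟩
  · have : {ω | (t : ℝ≥0∞) ≤ lastPassageTime M K ω} = I ⁻¹' {1} := by
      ext ω
      by_cases h : (t : ℝ≥0∞) ≤ lastPassageTime M K ω <;> simp [hIdef, survivalIndicator, h]
    rw [this]
    exact hIm.aemeasurable.nullMeasurable (measurableSet_singleton 1)
  · simp only [hprod]
    exact hZZi.const_mul _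
  · rw [hvar]
    refine integral_congr_ae ?_
    filter_upwards [hZ] with ω h
    rw [h]
  · simp only [hvar, hprod]
    rw [integral_const_mul, ← mul_assoc, one_div, inv_mul_cancel₀ (by positivity), one_mul]
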